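/- Let $d,k,n$ be integers with $k\ge 3$, $n\ge 2$ and $d\ge k-1$. There is a constant $c_{d,k,n}>0$, depending only on $d,k,n$ (in particular not on $q$), such that the following holds. Let $\mathbb F_q$ be a finite field with $\operatorname{char}(\mathbb F_q)>k$, and let $$f_0(x_1,\dots,x_n)=\sum_{j_1,\dots,j_k=1}^n c_{j_1,\dots,j_k}x_{j_1}\cdots x_{j_k},$$ where the coefficients $c_{j_1,\dots,j_k}\in\mathbb F_q$ are symmetric in the indices, be a form of degree $k$ defining a smooth hypersurface in $\mathbb P^{n-1}$. For $1\le j\le n$ put $$\Psi_j(\mathbf h^{(1)},\dots,\mathbf h^{(k-1)})=k!\sum_{j_1,\dots,j_{k-1}=1}^n c_{j_1,\dots,j_{k-1},j}\,h^{(1)}_{j_1}\cdots h^{(k-1)}_{j_{k-1}}.$$ On $\mathbb F_q((1/T))$ let $|\cdot|$ be the absolute value with $|\beta|=q^{e}$ if $T^e$ is the highest power of $T$ occurring in $\beta\neq 0$, and $|0|=0$, extended to vectors by the maximum over the coordinates. For $\beta=\sum_{i\le M}\beta_iT^i$ put $\|\beta\|=\left|\sum_{i\le -1}\beta_iT^i\right|$.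 Let $m$ be an integer with $d\le m\le kd/2$, and let $(b_1,\dots,b_{kd})\in\mathbb F_q^{kd}$ lie outside $A_m^{kd}$, where $A_m^{kd}$ consists of those tuples for which the $(kd-m)\times(m+1)$ matrix with $(i,j)$ entry $b_{i+j-1}$ has rank at most $m$. Put $\alpha=\sum_{r=1}^{kd}b_rT^{-r}$. Then the number $$N(\alpha)=\#\left\{(\mathbf u^{(1)},\dots,\mathbf u^{(k-1)})\in(\mathbb F_q[T]^n)^{k-1}:\ |\mathbf u^{(i)}|<q^d\ (1\le i\le k-1),\ \ \|\alpha\Psi_j(\mathbf u^{(1)},\dots,\mathbf u^{(k-1)})\|<q^{-d}\ (1\le j\le n)\right\}$$ is finite and satisfies $$N(\alpha)\le c_{d,k,n}\,q^{dn(k-1)-n\lfloor m/(k-1)\rfloor}.$$ -/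

import Mathlib

open scoped BigOperators Polynomial

universe u

noncomputable section

namespace MinorArcs

/-- Laurent series in `1/T` over `F`, i.e. the field `F((1/T))`. The variable of Mathlib's
`LaurentSeries` plays the role of `1/T`, so the coefficient of `T^i` of `β` is `β.coeff (-i)`. -/
abbrev SeriesInf (F : Type u) [Field F] : Type u := LaurentSeries F

/-- The element `T` of `F((1/T))`. -/
def tInf (F : Type u) [Field F] : SeriesInf F := HahnSeries.single (-1 : ℤ) (1 : F)

/-- The inclusion `F[T] → F((1/T))`. -/
def polyInf {F : Type u} [Field F] : F[X] →+* SeriesInf F :=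
  Polynomial.eval₂RingHom HahnSeries.C (tInf F)

/-- The absolute value on `F((1/T))` for a finite field `F` with `q` elements: `|β| = q^e` if
`T^e` is the highest power of `T` that occurs in `β`, and `|0| = 0`. -/
def absInf {F : Type u} [Field F] (β : SeriesInf F) : ℝ :=
  open Classical in if β = 0 then 0 else (Nat.card F : ℝ) ^ (-HahnSeries.order β)

/-- The fractional part `∑_{i ≤ -1} b_i T^i` of `β = ∑_{i ≤ M} b_i T^i`. -/
def fracInf {F : Type u} [Field F] (β : SeriesInf F) : SeriesInf F where
  coeff i := if 0 < i then β.coeff i else 0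
  isPWO_support' := β.isPWO_support.mono fun i hi => by
    by_cases h : 0 < i <;> simp_all

/-- `‖β‖ = |fractional part of β|`. -/
def normInf {F : Type u} [Field F] (β : SeriesInf F) : ℝ := absInf (fracInf β)

/-- The series `∑_{r=1}^{D} b_r T^{-r}`; the coordinate `b_r` is `b ⟨r - 1, _⟩`. -/
def seriesOf {F : Type u} [Field F] {D : ℕ} (b : Fin D → F) : SeriesInf F :=
  ∑ r : Fin D, HahnSeries.single ((r : ℤ) + 1) (b r)

/-- The `(D - m) × (m + 1)` matrix whose entry in row `i`, column `j` (counted from `1`) is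
`b_{i+j-1}`. -/
def hankel {F : Type u} {D : ℕ} (m : ℕ) (b : Fin D → F) :
    Matrix (Fin (D - m)) (Fin (m + 1)) F :=
  Matrix.of fun i j => b ⟨(i : ℕ) + (j : ℕ), by omega⟩

/-- The `F`-points of the major arcs `A_m^D` of level `m`: the above matrix has rank at most `m`. -/
def majorArcs (F : Type u) [Field F] (D m : ℕ) : Set (Fin D → F) :=
  {b | (hankel m b).rank ≤ m}

/-- Symmetric coefficients: `c_{σ(j)} = c_j` for all permutations `σ` of the `k` positions. -/
def IsSymmCoeff {F : Type u} {k n : ℕ} (c : (Fin k → Fin n) → F) : Prop :=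
  ∀ (σ : Equiv.Perm (Fin k)) (j : Fin k → Fin n), c (j ∘ σ) = c j

/-- The form `∑_{j_1, …, j_k} c_{j_1, …, j_k} x_{j_1} ⋯ x_{j_k}`. -/
def formOf {F : Type u} [Field F] {k n : ℕ} (c : (Fin k → Fin n) → F) :
    MvPolynomial (Fin n) F :=
  ∑ j : Fin k → Fin n, MvPolynomial.C (c j) * ∏ i : Fin k, MvPolynomial.X (j i)

/-- The form `f₀` defines a smooth hypersurface in `ℙ^{n-1}` (Jacobian criterion at all geometric
points). -/
def DefinesSmoothHypersurface {F : Type u} [Field F] {n : ℕ} (f₀ : MvPolynomial (Fin n) F) :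
    Prop :=
  ∀ x : Fin n → AlgebraicClosure F, x ≠ 0 → MvPolynomial.aeval x f₀ = 0 →
    ∃ i : Fin n, MvPolynomial.aeval x (MvPolynomial.pderiv i f₀) ≠ 0

/-- The multi-index `(j_1, …, j_{k-1}, j)`. -/
def appendIndex {k n : ℕ} (j' : Fin (k - 1) → Fin n) (j : Fin n) : Fin k → Fin n :=
  fun i => if h : (i : ℕ) < k - 1 then j' ⟨i, h⟩ else j

/-- The multilinear forms
`Ψ_j(h^{(1)}, …, h^{(k-1)}) = k! ∑ c_{j_1, …, j_{k-1}, j} h^{(1)}_{j_1} ⋯ h^{(k-1)}_{j_{k-1}}`,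
evaluated at vectors of polynomials. -/
def psi {F : Type u} [Field F] {k n : ℕ} (c : (Fin k → Fin n) → F) (j : Fin n)
    (h : Fin (k - 1) → Fin n → F[X]) : F[X] :=
  (k.factorial : F[X]) *
    ∑ j' : Fin (k - 1) → Fin n,
      Polynomial.C (c (appendIndex j' j)) * ∏ i : Fin (k - 1), h i (j' i)

/-- The set counted by `N(α)`: the tuples `u = (u^{(1)}, …, u^{(k-1)})` of vectors in `F[T]^n`
with `|u^{(i)}| < q^d` for all `i` (the absolute value of a vector is the maximum over its
coordinates) and `‖α Ψ_j(u)‖ < q^{-d}` for all `j`. -/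
def countSet {F : Type u} [Field F] {k n : ℕ} (d : ℕ) (c : (Fin k → Fin n) → F)
    (α : SeriesInf F) : Set (Fin (k - 1) → Fin n → F[X]) :=
  {u | (∀ i l, absInf (polyInf (u i l)) < (Nat.card F : ℝ) ^ d) ∧
    ∀ j : Fin n, normInf (α * polyInf (psi c j u)) < (Nat.card F : ℝ) ^ (-(d : ℤ))}

end MinorArcs

end

/-! Write r = k-1, e = ⌊m/r⌋, s = d-e, and let φ(p) be the coefficient of T^{-1} in αp. Since k! is
invertible, N(α) is at most the number of r-tuples of degree < d for which φ kills the first d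
shifts T^y of every component of the polarised gradient of f₀.

Davenport's shrinking argument is applied to one argument at a time. With the other arguments fixed,
the gradient is u ↦ Bu with B symmetric, and `finrank_shrinkSpace_add_le` trades degree < e+s for
degree < e together with s further annihilated shifts, at the cost of a factor q^{ns}. After all r
arguments have been shrunk, the gradient has degree at most re ≤ m and is killed by d+rs = kd-re ≥
kd-m shifts. As b lies outside the major arcs, the Hankel matrix is injective, so the gradient
vanishes identically (`eq_zero_of_notMem_majorArcs`).

It remains to count zeros of the gradient in the small box. Fixing the r-1 differences u_i - u_0
leaves n equations in u_0 whose leading forms are the gradient of f₀ on the diagonal. By smoothness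
these have no common zero except 0, so a weak Bézout bound (`ncard_zeros_le`) allows O(1) values of
u_0, hence O(q^{en(r-1)}) zeros. The total exponent is nsr + en(r-1) = dnr - ne. -/

open scoped BigOperators Polynomial

noncomputable section

namespace MinorArcs

/-! ### The shrinking lemma for symmetric matrices of polynomials -/

section Shrink

variable {F : Type*} [Field F] {n : ℕ}

/-- Vectors of polynomials of degree less than `P`. -/
def degBox (F : Type*) [Field F] (n P : ℕ) : Submodule F (Fin n → F[X]) :=
  Submodule.pi Set.univ fun _ => Polynomial.degreeLT F P

theorem mem_degBox {P : ℕ} {u : Fin n → F[X]} :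
    u ∈ degBox F n P ↔ ∀ l, u l ∈ Polynomial.degreeLT F P := by
  simp [degBox]

/-- A box of polynomial vectors as a product. -/
def degBoxEquiv (F : Type*) [Field F] (n P : ℕ) :
    degBox F n P ≃ₗ[F] (Fin n → Polynomial.degreeLT F P) where
  toFun u l := ⟨u.1 l, mem_degBox.1 u.2 l⟩
  invFun v := ⟨fun l => v l, mem_degBox.2 fun l => (v l).2⟩
  map_add' _ _ := rfl
  map_smul' _ _ := rfl
  left_inv _ := rfl
  right_inv _ := rfl

instance finite_degreeLT (P : ℕ) : Module.Finite F (Polynomial.degreeLT F P) :=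
  Module.Finite.equiv (Polynomial.degreeLTEquiv F P).symm

instance finite_degBox (P : ℕ) : Module.Finite F (degBox F n P) :=
  Module.Finite.equiv (degBoxEquiv F n P).symm

theorem finrank_degBox (P : ℕ) : Module.finrank F (degBox F n P) = n * P := by
  rw [(degBoxEquiv F n P).finrank_eq, Module.finrank_pi_fintype]
  simp [(Polynomial.degreeLTEquiv F P).finrank_eq]

/-- The vectors `u` of polynomials of degree less than `P` for which `φ` kills the first `Q`
shifts of all coordinates of `B u`. -/
def shrinkSpace (φ : F[X] →ₗ[F] F) (B : Matrix (Fin n) (Fin n) F[X]) (P Q : ℕ) :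
    Submodule F (Fin n → F[X]) where
  carrier := {u | (∀ l, u l ∈ Polynomial.degreeLT F P) ∧
    ∀ j, ∀ i < Q, φ (Polynomial.X ^ i * B.mulVec u j) = 0}
  add_mem' := by
    rintro u v ⟨hu, hu'⟩ ⟨hv, hv'⟩
    refine ⟨fun l => Submodule.add_mem _ (hu l) (hv l), fun j i hi => ?_⟩
    rw [Matrix.mulVec_add, Pi.add_apply, mul_add, map_add, hu' j i hi, hv' j i hi, add_zero]
  zero_mem' := by
    refine ⟨fun l => Submodule.zero_mem _, fun j i _ => ?_⟩
    rw [Matrix.mulVec_zero]; simp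
  smul_mem' := by
    rintro a u ⟨hu, hu'⟩
    refine ⟨fun l => Submodule.smul_mem _ _ (hu l), fun j i hi => ?_⟩
    rw [Matrix.mulVec_smul, Pi.smul_apply, mul_smul_comm, map_smul, hu' j i hi, smul_zero]

variable (φ : F[X] →ₗ[F] F) (B : Matrix (Fin n) (Fin n) F[X])

theorem mem_shrinkSpace {P Q : ℕ} {u : Fin n → F[X]} :
    u ∈ shrinkSpace φ B P Q ↔ (∀ l, u l ∈ Polynomial.degreeLT F P) ∧
      ∀ j, ∀ i < Q, φ (Polynomial.X ^ i * B.mulVec u j) = 0 := Iff.rfl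

theorem shrinkSpace_le_degBox (P Q : ℕ) : shrinkSpace φ B P Q ≤ degBox F n P :=
  fun _ hu => mem_degBox.2 hu.1

instance finite_shrinkSpace (P Q : ℕ) : Module.Finite F (shrinkSpace φ B P Q) :=
  Submodule.finiteDimensional_of_le (shrinkSpace_le_degBox φ B P Q)

/-- The bilinear form `(u, v) ↦ φ (vᵀ B u)`. -/
def boxPairing : (Fin n → F[X]) →ₗ[F] (Fin n → F[X]) →ₗ[F] F :=
  LinearMap.mk₂ F (fun u v => φ (v ⬝ᵥ B.mulVec u))
    (fun u u' v => by rw [Matrix.mulVec_add, dotProduct_add, map_add])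
    (fun a u v => by rw [Matrix.mulVec_smul, dotProduct_smul, map_smul])
    (fun u v v' => by rw [add_dotProduct, map_add])
    (fun a u v => by rw [smul_dotProduct, map_smul])

theorem boxPairing_apply (u v : Fin n → F[X]) :
    boxPairing φ B u v = φ (v ⬝ᵥ B.mulVec u) := rfl

theorem boxPairing_comm (hB : B.IsSymm) (u v : Fin n → F[X]) :
    boxPairing φ B u v = boxPairing φ B v u := by
  rw [boxPairing_apply, boxPairing_apply, Matrix.dotProduct_mulVec, ← Matrix.mulVec_transpose,
    hB.eq, dotProduct_comm]

/-- The pairing between two boxes. -/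
def boxMap (P Q : ℕ) : degBox F n P →ₗ[F] degBox F n Q →ₗ[F] F :=
  (boxPairing φ B).domRestrict₁₂ (degBox F n P) (degBox F n Q)

/-- The powers X^i with i < Q span the polynomials of degree < Q, so the shift conditions mean
orthogonality to a whole box. This makes rank-nullity available. -/
theorem shrinkSpace_eq_map_ker (P Q : ℕ) :
    shrinkSpace φ B P Q = (LinearMap.ker (boxMap φ B P Q)).map (degBox F n P).subtype := by
  ext u
  simp only [Submodule.mem_map, LinearMap.mem_ker, Submodule.subtype_apply, Subtype.exists,
    exists_and_right, exists_eq_right]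
  constructor
  · rintro ⟨hu, hu'⟩
    refine ⟨mem_degBox.2 hu, LinearMap.ext fun v => ?_⟩
    change φ ((v : Fin n → F[X]) ⬝ᵥ B.mulVec u) = 0
    rw [dotProduct, map_sum]
    refine Finset.sum_eq_zero fun j _ => ?_
    have hv := mem_degBox.1 v.2 j
    have key : ∀ p ∈ Polynomial.degreeLT F Q, φ (p * B.mulVec u j) = 0 := by
      intro p hp
      classical
      rw [Polynomial.degreeLT_eq_span_X_pow] at hp
      induction hp using Submodule.span_induction with
      | mem x hx =>
        simp only [Finset.coe_image, Finset.coe_range, Set.mem_image, Set.mem_Iio] at hx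
        obtain ⟨i, hi, rfl⟩ := hx
        exact hu' j i hi
      | zero => simp
      | add x y _ _ hx hy => rw [add_mul, map_add, hx, hy, add_zero]
      | smul a x _ hx => rw [smul_mul_assoc, map_smul, hx, smul_zero]
    exact key _ hv
  · rintro ⟨hu, hu'⟩
    refine ⟨mem_degBox.1 hu, fun j i hi => ?_⟩
    have hv : Pi.single j (Polynomial.X ^ i) ∈ degBox F n Q := by
      refine mem_degBox.2 fun l => ?_
      rcases eq_or_ne l j with rfl | h
      · rw [Pi.single_eq_same, Polynomial.mem_degreeLT, Polynomial.degree_X_pow]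
        exact_mod_cast hi
      · rw [Pi.single_eq_of_ne h]; exact Submodule.zero_mem _
    have := LinearMap.congr_fun hu' ⟨_, hv⟩
    change φ (Pi.single j (Polynomial.X ^ i) ⬝ᵥ B.mulVec u) = 0 at this
    rwa [single_dotProduct] at this

theorem finrank_range_boxMap_add (P Q : ℕ) :
    Module.finrank F (LinearMap.range (boxMap φ B P Q)) +
      Module.finrank F (shrinkSpace φ B P Q) = n * P := by
  rw [shrinkSpace_eq_map_ker, Submodule.finrank_map_subtype_eq,
    LinearMap.finrank_range_add_finrank_ker, finrank_degBox]

/-- For symmetric B the two pairings are transposes of each other, and row rank equals column rank.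
-/
theorem finrank_range_boxMap_comm (hB : B.IsSymm) (P Q : ℕ) :
    Module.finrank F (LinearMap.range (boxMap φ B P Q)) =
      Module.finrank F (LinearMap.range (boxMap φ B Q P)) := by
  have h : boxMap φ B P Q = (boxMap φ B Q P).dualMap ∘ₗ
      (Module.evalEquiv F (degBox F n P)).toLinearMap := by
    ext u v
    exact boxPairing_comm φ B hB _ _
  rw [h, LinearMap.range_comp_of_range_eq_top _ (LinearEquiv.range _),
    LinearMap.finrank_range_dualMap_eq_finrank_range]

/-- Multiplication by the variable on vectors of polynomials. -/
def mulX (F : Type*) [Field F] (n : ℕ) : (Fin n → F[X]) →ₗ[F] (Fin n → F[X]) where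
  toFun u l := Polynomial.X * u l
  map_add' u v := by ext1 l; simp [mul_add]
  map_smul' a u := by ext1 l; simp

theorem mulX_injective : Function.Injective (mulX F n) := fun u v h => by
  ext1 l
  exact mul_left_cancel₀ Polynomial.X_ne_zero (congr_fun h l)

theorem mulVec_mulX (u : Fin n → F[X]) (j : Fin n) :
    B.mulVec (mulX F n u) j = Polynomial.X * B.mulVec u j := by
  have : mulX F n u = (Polynomial.X : F[X]) • u := rfl
  rw [this, Matrix.mulVec_smul, Pi.smul_apply, smul_eq_mul]

theorem X_mul_mem_degreeLT_succ {P : ℕ} {p : F[X]} :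
    Polynomial.X * p ∈ Polynomial.degreeLT F (P + 1) ↔ p ∈ Polynomial.degreeLT F P := by
  rw [Polynomial.mem_degreeLT, Polynomial.mem_degreeLT]
  rcases eq_or_ne p 0 with rfl | hp
  · simp only [mul_zero, Polynomial.degree_zero]
    exact iff_of_true (WithBot.bot_lt_coe _) (WithBot.bot_lt_coe _)
  · rw [mul_comm, Polynomial.degree_mul_X, Polynomial.degree_eq_natDegree hp]
    norm_cast
    omega

/-- With K the middle space, K + XK lies in the space for (P+2, Q), while K ∩ XK lies in X times the
space for (P, Q+2). The dimension formula for sum and intersection concludes. -/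
theorem finrank_shrinkSpace_convex (P Q : ℕ) :
    2 * Module.finrank F (shrinkSpace φ B (P + 1) (Q + 1)) ≤
      Module.finrank F (shrinkSpace φ B (P + 2) Q) +
        Module.finrank F (shrinkSpace φ B P (Q + 2)) := by
  set K := shrinkSpace φ B (P + 1) (Q + 1) with hK
  have hsup : K ⊔ K.map (mulX F n) ≤ shrinkSpace φ B (P + 2) Q := by
    refine sup_le ?_ ?_
    · rintro u ⟨hu, hu'⟩
      exact ⟨fun l => Polynomial.degreeLT_mono (by omega) (hu l),
        fun j i hi => hu' j i (by omega)⟩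
    · rintro _ ⟨u, ⟨hu, hu'⟩, rfl⟩
      refine ⟨fun l => X_mul_mem_degreeLT_succ.2 (hu l), fun j i hi => ?_⟩
      rw [mulVec_mulX, ← mul_assoc, ← pow_succ]
      exact hu' j (i + 1) (by omega)
  have hinf : K ⊓ K.map (mulX F n) ≤ (shrinkSpace φ B P (Q + 2)).map (mulX F n) := by
    rintro _ ⟨⟨hv, hv'⟩, ⟨u, ⟨hu, hu'⟩, rfl⟩⟩
    refine ⟨u, ⟨fun l => X_mul_mem_degreeLT_succ.1 (hv l), fun j i hi => ?_⟩, rfl⟩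
    -- The shift 0 is controlled by u ∈ K, the shift i+1 by Xu ∈ K; together they reach Q+2 shifts.
    rcases i with _ | i
    · exact hu' j 0 (by omega)
    · have := hv' j i (by omega)
      rwa [mulVec_mulX, ← mul_assoc, ← pow_succ] at this
  have hm : ∀ S : Submodule F (Fin n → F[X]),
      Module.finrank F (S.map (mulX F n)) = Module.finrank F S := fun S =>
    ((S.equivMapOfInjective _ mulX_injective).finrank_eq).symm
  have h1 := Submodule.finrank_mono hsup
  have h2 := Submodule.finrank_mono hinf
  have h3 := Submodule.finrank_sup_add_finrank_inf_eq K (K.map (mulX F n))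
  rw [hm] at h2 h3
  omega

/-- A concave sequence that is symmetric about `N / 2` increases on the first half. -/
theorem le_of_concave_of_symm {N : ℕ} {r : ℕ → ℤ}
    (hc : ∀ p, p + 2 ≤ N → r (p + 2) + r p ≤ 2 * r (p + 1))
    (hs : ∀ p ≤ N, r p = r (N - p)) {p : ℕ} (hp : 2 * (p + 1) ≤ N) : r p ≤ r (p + 1) := by
  have hd : ∀ t, p + 1 + t ≤ N → r (p + 1 + t) - r (p + t) ≤ r (p + 1) - r p := by
    intro t
    induction t with
    | zero => simp
    | succ t ih =>
      intro ht
      have h1 := ih (by omega)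
      have h2 := hc (p + t) (by omega)
      have e1 : p + 1 + (t + 1) = p + t + 2 := by omega
      have e2 : p + (t + 1) = p + t + 1 := by omega
      have e3 : p + 1 + t = p + t + 1 := by omega
      rw [e1, e2]; rw [e3] at h1
      linarith
  -- By symmetry, the increment from N-p-1 to N-p is minus the one from p to p+1; by concavity it is
  -- also at most the latter, which is therefore nonnegative.
  have h := hd (N - 2 * p - 1) (by omega)
  have e1 : p + 1 + (N - 2 * p - 1) = N - p := by omega
  have e2 : p + (N - 2 * p - 1) = N - (p + 1) := by omega
  rw [e1, e2, ← hs p (by omega), ← hs (p + 1) (by omega)] at h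
  linarith

/-- Along p + q = P+1+Q the rank of the pairing is np minus the dimension. It is concave in p by
convexity of the dimensions and symmetric under p ↔ q, so it does not drop from P to P+1, which is
still in the first half. -/
theorem finrank_shrinkSpace_succ_le (hB : B.IsSymm) {P Q : ℕ} (h : P + 1 ≤ Q) :
    Module.finrank F (shrinkSpace φ B (P + 1) Q) ≤
      n + Module.finrank F (shrinkSpace φ B P (Q + 1)) := by
  have hr : ∀ P Q, (Module.finrank F (LinearMap.range (boxMap φ B P Q)) : ℤ) =
      n * P - Module.finrank F (shrinkSpace φ B P Q) := fun P Q => by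
    have := finrank_range_boxMap_add φ B P Q
    have h' : (Module.finrank F (LinearMap.range (boxMap φ B P Q)) : ℤ) +
      Module.finrank F (shrinkSpace φ B P Q) = n * P := by exact_mod_cast this
    linarith
  have key := le_of_concave_of_symm (N := P + 1 + Q)
    (r := fun p => (Module.finrank F (LinearMap.range (boxMap φ B p (P + 1 + Q - p))) : ℤ))
    (fun p hp => by
      obtain ⟨t, ht⟩ := Nat.exists_eq_add_of_le hp
      have e0 : P + 1 + Q - p = t + 2 := by omega
      have e1 : P + 1 + Q - (p + 1) = t + 1 := by omega
      have e2 : P + 1 + Q - (p + 2) = t := by omega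
      simp only [hr]
      rw [e0, e1, e2]
      have := finrank_shrinkSpace_convex φ B p t
      zify at this
      push_cast
      linarith)
    (fun p hp => by
      rw [finrank_range_boxMap_comm φ B hB, Nat.sub_sub_self hp])
    (p := P) (by omega)
  have e0 : P + 1 + Q - P = Q + 1 := by omega
  have e1 : P + 1 + Q - (P + 1) = Q := by omega
  simp only [hr] at key
  rw [e0, e1] at key
  zify
  push_cast at key
  linarith

theorem finrank_shrinkSpace_add_le (hB : B.IsSymm) (P s : ℕ) {Q : ℕ} (h : P + s ≤ Q) :
    Module.finrank F (shrinkSpace φ B (P + s) Q) ≤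
      n * s + Module.finrank F (shrinkSpace φ B P (Q + s)) := by
  induction s generalizing Q with
  | zero => simp
  | succ s ih =>
    have h1 := finrank_shrinkSpace_succ_le φ B hB (P := P + s) (Q := Q) (by omega)
    have h2 := ih (Q := Q + 1) (by omega)
    rw [show Q + (s + 1) = Q + 1 + s by omega, mul_add_one]
    rw [← add_assoc P]
    omega

theorem ncard_shrinkSpace_add_le [Finite F] (hB : B.IsSymm) (P s : ℕ) {Q : ℕ} (h : P + s ≤ Q) :
    (shrinkSpace φ B (P + s) Q : Set (Fin n → F[X])).ncard ≤
      Nat.card F ^ (n * s) * (shrinkSpace φ B P (Q + s) : Set (Fin n → F[X])).ncard := by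
  have hc : ∀ P Q, (shrinkSpace φ B P Q : Set (Fin n → F[X])).ncard =
      Nat.card F ^ Module.finrank F (shrinkSpace φ B P Q) := fun P Q => by
    rw [← Module.natCard_eq_pow_finrank (K := F)]; rfl
  rw [hc, hc, ← pow_add]
  exact Nat.pow_le_pow_right Nat.card_pos (finrank_shrinkSpace_add_le φ B hB P s h)

end Shrink

/-! ### A weak Bézout bound by integral dependence -/

section Bezout

open MvPolynomial

variable {L : Type*} [Field L] {n D : ℕ}

theorem homogeneousComponent_mul_of_isHomogeneous {σ R : Type*} [CommSemiring R]
    {G : MvPolynomial σ R} (hG : G.IsHomogeneous D) (A : MvPolynomial σ R) (a : ℕ) :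
    homogeneousComponent (a + D) (A * G) = homogeneousComponent a A * G := by
  conv_lhs => rw [← sum_homogeneousComponent A, Finset.sum_mul, map_sum]
  have h : ∀ i, homogeneousComponent (a + D) (homogeneousComponent i A * G) =
      if i = a then homogeneousComponent a A * G else 0 := by
    intro i
    rw [homogeneousComponent_of_mem (n := i + D)
      ((homogeneousComponent_isHomogeneous i A).mul hG)]
    split_ifs with h1 h2 h2
    · rw [h2]
    · omega
    · omega
    · rfl
  simp only [h, Finset.sum_ite_eq', Finset.mem_range]
  split_ifs with h1
  · rfl
  · rw [homogeneousComponent_eq_zero _ _ (by omega), zero_mul]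

/-- In any representation, only the degree a components of the coefficients contribute in degree
a+D. -/
theorem exists_homogeneous_combination {ι σ R : Type*} [Fintype ι] [CommRing R]
    {G : ι → MvPolynomial σ R} (hG : ∀ j, (G j).IsHomogeneous D) {a : ℕ} {p : MvPolynomial σ R}
    (hp : p.IsHomogeneous (a + D)) (hpG : p ∈ Ideal.span (Set.range G)) :
    ∃ A : ι → MvPolynomial σ R, (∀ j, (A j).IsHomogeneous a) ∧ p = ∑ j, A j * G j := by
  obtain ⟨A, hA⟩ := Ideal.mem_span_range_iff_exists_fun.1 hpG
  refine ⟨fun j => homogeneousComponent a (A j), fun j => homogeneousComponent_isHomogeneous _ _,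
    ?_⟩
  rw [← homogeneousComponent_eq_self hp, ← hA, map_sum]
  exact Finset.sum_congr rfl fun j _ => homogeneousComponent_mul_of_isHomogeneous (hG j) _ _

/-- If the leading forms of `g` generate an ideal that contains powers of all variables, then the
polynomial ring is finite over the algebra generated by `g`. -/
theorem finite_adjoin_range {g G : Fin n → MvPolynomial (Fin n) L} (hD : 0 < D)
    (hG : ∀ j, (G j).IsHomogeneous D) (hgG : ∀ j, (g j - G j).totalDegree < D) {M : ℕ}
    (hX : ∀ i, X i ^ M ∈ Ideal.span (Set.range G)) :
    Module.Finite (Algebra.adjoin L (Set.range g)) (MvPolynomial (Fin n) L) := by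
  -- Pigeonhole: a monomial of degree at least N has some exponent at least M+D.
  set N := n * (M + D) + 1 with hN
  have hEfin : {e : Fin n →₀ ℕ | e.degree < N}.Finite := by
    refine (Set.finite_Iic (Finsupp.equivFunOnFinite.symm fun _ : Fin n => N)).subset ?_
    intro e he i
    exact (Finsupp.le_degree i e).trans (le_of_lt he)
  set T : Submodule (Algebra.adjoin L (Set.range g)) (MvPolynomial (Fin n) L) :=
    Submodule.span _ ((fun e => monomial e (1 : L)) '' {e : Fin n →₀ ℕ | e.degree < N}) with hT
  have hC : ∀ (a : L) {p : MvPolynomial (Fin n) L}, p ∈ T → C a * p ∈ T := by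
    intro a p hp
    exact T.smul_mem (algebraMap L (Algebra.adjoin L (Set.range g)) a) hp
  have hg : ∀ j {p : MvPolynomial (Fin n) L}, p ∈ T → p * g j ∈ T := by
    intro j p hp
    rw [mul_comm]
    exact T.smul_mem ⟨g j, Algebra.subset_adjoin ⟨j, rfl⟩⟩ hp
  have hpoly : ∀ s, (∀ e : Fin n →₀ ℕ, e.degree < s → monomial e (1 : L) ∈ T) →
      ∀ p : MvPolynomial (Fin n) L, p.totalDegree < s → p ∈ T := by
    intro s hs p hp
    rw [p.as_sum]
    refine Submodule.sum_mem _ fun e he => ?_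
    rw [← mul_one (coeff e p), ← C_mul_monomial]
    refine hC _ (hs e (lt_of_le_of_lt ?_ hp))
    exact le_totalDegree he
  have hmon : ∀ s, ∀ e : Fin n →₀ ℕ, e.degree < s → monomial e (1 : L) ∈ T := by
    intro s
    induction s with
    | zero => intro e he; omega
    | succ s ih =>
      intro e he
      rcases lt_or_ge e.degree N with h | h
      · exact Submodule.subset_span ⟨e, h, rfl⟩
      obtain ⟨i, hi⟩ : ∃ i, M + D ≤ e i := by
        by_contra! hcon
        have : e.degree ≤ n * (M + D) := by
          rw [Finsupp.degree_eq_sum]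
          refine (Finset.sum_le_sum fun i _ => (hcon i).le).trans ?_
          simp
        omega
      obtain ⟨A, hA, hAX⟩ := exists_homogeneous_combination hG (a := M)
        (isHomogeneous_X_pow (R := L) i (M + D))
        (by rw [pow_add]; exact Ideal.mul_mem_right _ _ (hX i))
      set e' := e - Finsupp.single i (M + D) with he'
      have hle : Finsupp.single i (M + D) ≤ e := by
        rw [Finsupp.single_le_iff]; exact hi
      have hee : e = Finsupp.single i (M + D) + e' := (add_tsub_cancel_of_le hle).symm
      have hdeg : e.degree = M + D + e'.degree := by
        conv_lhs => rw [hee]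
        rw [map_add, Finsupp.degree_single]
      -- Replacing G_j by g_j - (g_j - G_j) in X_i^{M+D} = ∑ A_j G_j writes the monomial through
      -- multiples of g_j with coefficients of lower degree, plus a remainder of lower degree.
      have hm : monomial e (1 : L) = ∑ j, (monomial e' 1 * A j * g j -
          monomial e' 1 * A j * (g j - G j)) := by
        have : monomial e (1 : L) = monomial e' 1 * X i ^ (M + D) := by
          rw [X_pow_eq_monomial, monomial_mul, one_mul, add_comm e', ← hee]
        rw [this, hAX, Finset.mul_sum]
        exact Finset.sum_congr rfl fun j _ => by ring
      have hd : ∀ j, (monomial e' (1 : L) * A j).totalDegree + D ≤ s := by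
        intro j
        have h1 := totalDegree_mul (monomial e' (1 : L)) (A j)
        have h2 := (hA j).totalDegree_le
        have h3 : (monomial e' (1 : L)).totalDegree = e'.degree := by
          rw [totalDegree_monomial _ one_ne_zero]; rfl
        omega
      rw [hm]
      refine Submodule.sum_mem _ fun j _ => Submodule.sub_mem _ (hg j ?_) ?_
      · have := hd j
        exact hpoly s ih _ (by omega)
      · have h1 := hd j
        have h2 := totalDegree_mul (monomial e' (1 : L) * A j) (g j - G j)
        have h3 := hgG j
        exact hpoly s ih _ (by omega)
  have htop : T = ⊤ := by
    rw [eq_top_iff]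
    intro p _
    exact hpoly (p.totalDegree + 1) (hmon _) p (Nat.lt_succ_self _)
  exact ⟨Submodule.fg_def.2 ⟨_, hEfin.image _, htop⟩⟩

/-- The polynomial ring has transcendence degree n and is algebraic over the algebra generated by
these n elements, which therefore form a transcendence basis. -/
theorem algebraicIndependent_of_finite {g : Fin n → MvPolynomial (Fin n) L}
    (hfin : Module.Finite (Algebra.adjoin L (Set.range g)) (MvPolynomial (Fin n) L)) :
    AlgebraicIndependent L g := by
  have : Algebra.IsIntegral (Algebra.adjoin L (Set.range g)) (MvPolynomial (Fin n) L) :=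
    Algebra.IsIntegral.of_finite _ _
  have : Algebra.IsAlgebraic (Algebra.adjoin L (Set.range g)) (MvPolynomial (Fin n) L) :=
    inferInstance
  refine (Algebra.IsAlgebraic.isTranscendenceBasis_of_lift_le_trdeg_of_finite L g ?_).1
  simp [MvPolynomial.trdeg_of_isDomain]

theorem eq_zero_of_coeff_fin_eq_zero {m : ℕ} {p : MvPolynomial (Fin n) L} (hp : p.totalDegree ≤ m)
    (h : ∀ e : Fin n → Fin (m + 1),
      coeff (Finsupp.equivFunOnFinite.symm fun i => (e i : ℕ)) p = 0) : p = 0 := by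
  ext e
  rw [coeff_zero]
  by_contra hne
  have h1 : ∀ i, e i < m + 1 := fun i => by
    have h2 := le_totalDegree (mem_support_iff.2 hne)
    have h3 := Finsupp.le_degree i e
    have h4 : e.degree ≤ p.totalDegree := h2
    omega
  apply hne
  rw [← h fun i => ⟨e i, h1 i⟩]
  congr 1
  ext i
  simp

/-- A polynomial satisfies an algebraic relation of bounded degree over any `n` algebraically
independent polynomials of bounded degree. -/
theorem exists_relation {g : Fin n → MvPolynomial (Fin n) L} (hg : AlgebraicIndependent L g)
    (hD : 0 < D) (hgD : ∀ j, (g j).totalDegree ≤ D) (i : Fin n) :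
    ∃ P : (Algebra.adjoin L (Set.range g))[X], P ≠ 0 ∧ P.natDegree ≤ (n * D + 1) ^ n ∧
      Polynomial.aeval (X i : MvPolynomial (Fin n) L) P = 0 := by
  classical
  -- Chosen so that the (R+1)^{n+1} unknowns outnumber the (m+1)^n ≤ R(R+1)^n coefficient equations.
  set R := (n * D + 1) ^ n with hR
  set m := R + n * (R * D) with hm
  -- the combinations of `x ^ j * g ^ β` with `j ≤ R` and `β < R + 1`
  let Mon : (Fin n → Fin (R + 1)) → MvPolynomial (Fin n) L := fun β => ∏ l, g l ^ (β l : ℕ)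
  let comb : (Fin (R + 1) × (Fin n → Fin (R + 1)) → L) →ₗ[L] MvPolynomial (Fin n) L :=
    Fintype.linearCombination L fun jb => X i ^ (jb.1 : ℕ) * Mon jb.2
  have hcomb : ∀ a, comb a = ∑ jb, a jb • (X i ^ (jb.1 : ℕ) * Mon jb.2) := fun a =>
    Fintype.linearCombination_apply L _ a
  have hdeg : ∀ a, (comb a).totalDegree ≤ m := by
    intro a
    rw [hcomb]
    refine totalDegree_finsetSum_le fun jb _ => (totalDegree_smul_le _ _).trans ?_
    refine (totalDegree_mul _ _).trans (add_le_add ?_ ?_)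
    · rw [totalDegree_X_pow]; omega
    · refine (totalDegree_finsetProd _ _).trans ?_
      have : ∀ l ∈ Finset.univ, (g l ^ (jb.2 l : ℕ)).totalDegree ≤ R * D := fun l _ =>
        (totalDegree_pow _ _).trans (Nat.mul_le_mul (by omega) (hgD l))
      refine (Finset.sum_le_sum this).trans ?_
      simp
  let coefs : MvPolynomial (Fin n) L →ₗ[L] ((Fin n → Fin (m + 1)) → L) :=
    LinearMap.pi fun e => lcoeff L (Finsupp.equivFunOnFinite.symm fun i => (e i : ℕ))
  obtain ⟨a, ha, ha0⟩ : ∃ a, comb a = 0 ∧ a ≠ 0 := by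
    have hlt : Module.finrank L ((Fin n → Fin (m + 1)) → L) <
        Module.finrank L (Fin (R + 1) × (Fin n → Fin (R + 1)) → L) := by
      simp only [Module.finrank_fintype_fun_eq_card, Fintype.card_prod, Fintype.card_fun,
        Fintype.card_fin]
      have h1 : m + 1 ≤ (n * D + 1) * (R + 1) := by rw [hm]; nlinarith
      calc (m + 1) ^ n ≤ ((n * D + 1) * (R + 1)) ^ n := Nat.pow_le_pow_left h1 n
        _ = R * (R + 1) ^ n := by rw [mul_pow, hR]
        _ < (R + 1) * (R + 1) ^ n := by
          exact Nat.mul_lt_mul_of_pos_right (Nat.lt_succ_self _) (by positivity)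
    have hker := LinearMap.ker_ne_bot_of_finrank_lt (f := coefs ∘ₗ comb) hlt
    obtain ⟨a, ha, ha0⟩ := Submodule.exists_mem_ne_zero_of_ne_bot hker
    refine ⟨a, eq_zero_of_coeff_fin_eq_zero (hdeg a) fun e => ?_, ha0⟩
    exact congr_fun (LinearMap.mem_ker.1 ha) e
  let gB : Fin n → Algebra.adjoin L (Set.range g) := fun l =>
    ⟨g l, Algebra.subset_adjoin ⟨l, rfl⟩⟩
  let b : Fin (R + 1) → Algebra.adjoin L (Set.range g) := fun j =>
    ∑ β : Fin n → Fin (R + 1), a (j, β) • ∏ l, gB l ^ (β l : ℕ)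
  have hb : ∀ j, (b j : MvPolynomial (Fin n) L) = ∑ β, a (j, β) • Mon β := by
    intro j
    simp [b, Mon, gB]
  refine ⟨∑ j : Fin (R + 1), Polynomial.monomial (j : ℕ) (b j), ?_, ?_, ?_⟩
  -- If P were zero, every b_j would be a vanishing polynomial in g, and algebraic independence
  -- would force all a (j, β) to vanish.
  · intro h0
    obtain ⟨⟨j, β⟩, hjβ⟩ := Function.ne_iff.1 ha0
    have hbj : b j = 0 := by
      have := congrArg (fun p => Polynomial.coeff p (j : ℕ)) h0
      simpa [Polynomial.finsetSum_coeff, Polynomial.coeff_monomial, Fin.val_inj] using this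
    have h1 : aeval g (∑ β : Fin n → Fin (R + 1),
        monomial (Finsupp.equivFunOnFinite.symm fun l => (β l : ℕ)) (a (j, β))) = 0 := by
      have h0 : (b j : MvPolynomial (Fin n) L) = 0 := by rw [hbj]; rfl
      rw [← h0, hb, map_sum]
      refine Finset.sum_congr rfl fun β _ => ?_
      rw [aeval_monomial, Finsupp.prod_fintype _ _ (by simp), Algebra.smul_def]
      rfl
    have h2 := hg.eq_zero_of_aeval_eq_zero _ h1
    have h3 := congrArg (coeff (Finsupp.equivFunOnFinite.symm fun l => (β l : ℕ))) h2
    rw [coeff_sum, Finset.sum_eq_single β] at h3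
    · exact hjβ (by simpa using h3)
    · intro β' _ hne
      rw [coeff_monomial, if_neg]
      intro heq
      apply hne
      funext l
      exact Fin.ext (congr_fun (Finsupp.equivFunOnFinite.symm.injective heq) l)
    · simp
  · refine Polynomial.natDegree_sum_le_of_forall_le _ _ fun j _ => ?_
    exact (Polynomial.natDegree_monomial_le _).trans (by omega)
  · rw [← ha, hcomb, map_sum, Fintype.sum_prod_type]
    refine Finset.sum_congr rfl fun j _ => ?_
    rw [Polynomial.aeval_monomial]
    change (b j : MvPolynomial (Fin n) L) * _ = _
    rw [hb, Finset.sum_mul]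
    refine Finset.sum_congr rfl fun β _ => ?_
    rw [smul_mul_assoc, mul_comm]

/-- A weak form of Bézout's theorem: a bound for the number of common zeros of `n` polynomials in
`n` variables whose leading forms have no common zero at infinity. -/
theorem ncard_zeros_le {g G : Fin n → MvPolynomial (Fin n) L} (hD : 0 < D)
    (hG : ∀ j, (G j).IsHomogeneous D) (hgG : ∀ j, (g j - G j).totalDegree < D) {M : ℕ}
    (hX : ∀ i, X i ^ M ∈ Ideal.span (Set.range G)) :
    {z : Fin n → L | ∀ j, eval z (g j) = 0}.Finite ∧
      {z : Fin n → L | ∀ j, eval z (g j) = 0}.ncard ≤ ((n * D + 1) ^ n) ^ n := by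
  classical
  have hfin := finite_adjoin_range hD hG hgG hX
  have hind := algebraicIndependent_of_finite hfin
  have hgD : ∀ j, (g j).totalDegree ≤ D := fun j => by
    have : g j = (g j - G j) + G j := by ring
    rw [this]
    exact (totalDegree_add _ _).trans (max_le (hgG j).le (hG j).totalDegree_le)
  have hint : Algebra.IsIntegral (Algebra.adjoin L (Set.range g)) (MvPolynomial (Fin n) L) :=
    Algebra.IsIntegral.of_finite _ _
  -- The algebra L[g] is a polynomial ring. Over an integrally closed base the minimal polynomial
  -- has least degree among all nonzero relations, so the possibly non-monic relation of
  -- `exists_relation` bounds its degree.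
  have hcl : IsIntegrallyClosed (Algebra.adjoin L (Set.range g)) :=
    IsIntegrallyClosed.of_equiv hind.aevalEquiv.toRingEquiv
  rcases Set.eq_empty_or_nonempty {z : Fin n → L | ∀ j, eval z (g j) = 0} with he | ⟨z₀, hz₀⟩
  · rw [he]; simp
  let ev : (Fin n → L) → (Algebra.adjoin L (Set.range g)) →ₐ[L] L := fun z =>
    (aeval z).comp (Algebra.adjoin L (Set.range g)).val
  -- All common zeros induce the same evaluation on L[g], so the i-th coordinates of all of them are
  -- roots of one polynomial `Q i`.
  have hev : ∀ z, (∀ j, eval z (g j) = 0) → ev z = ev z₀ := by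
    intro z hz
    refine AlgHom.adjoin_ext ?_
    rintro _ ⟨j, rfl⟩
    change aeval z (g j) = aeval z₀ (g j)
    rw [aeval_eq_eval, aeval_eq_eval]
    exact (hz j).trans (hz₀ j).symm
  let Q : Fin n → L[X] := fun i =>
    (minpoly (Algebra.adjoin L (Set.range g)) (X i : MvPolynomial (Fin n) L)).map
      (ev z₀ : _ →+* L)
  have hmon : ∀ i, (minpoly (Algebra.adjoin L (Set.range g))
      (X i : MvPolynomial (Fin n) L)).Monic := fun i => minpoly.monic (hint.isIntegral _)
  have hQ0 : ∀ i, Q i ≠ 0 := fun i => ((hmon i).map _).ne_zero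
  have hQdeg : ∀ i, (Q i).natDegree ≤ (n * D + 1) ^ n := by
    intro i
    obtain ⟨P, hP0, hPdeg, hP⟩ := exists_relation hind hD hgD i
    refine Polynomial.natDegree_map_le.trans (le_trans ?_ hPdeg)
    exact Polynomial.natDegree_le_natDegree
      (minpoly.IsIntegrallyClosed.degree_le_of_ne_zero hP0 hP)
  have hroot : ∀ z, (∀ j, eval z (g j) = 0) → ∀ i, z i ∈ (Q i).roots.toFinset := by
    intro z hz i
    rw [Multiset.mem_toFinset, Polynomial.mem_roots (hQ0 i), Polynomial.IsRoot.def]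
    have h1 := minpoly.aeval (Algebra.adjoin L (Set.range g)) (X i : MvPolynomial (Fin n) L)
    have h2 := congrArg (aeval z : MvPolynomial (Fin n) L →ₐ[L] L) h1
    rw [map_zero, Polynomial.aeval_def] at h2
    have h3 := Polynomial.hom_eval₂ (minpoly (Algebra.adjoin L (Set.range g))
      (X i : MvPolynomial (Fin n) L)) (algebraMap _ _)
      (aeval z : MvPolynomial (Fin n) L →ₐ[L] L).toRingHom (X i)
    rw [AlgHom.toRingHom_eq_coe, RingHom.coe_coe, h2, aeval_X] at h3
    simp only [Q, Polynomial.eval_map]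
    rw [h3, ← hev z hz]
    rfl
  have hsub : {z : Fin n → L | ∀ j, eval z (g j) = 0} ⊆
      (Fintype.piFinset fun i => (Q i).roots.toFinset : Finset (Fin n → L)) := by
    intro z hz
    rw [Finset.mem_coe, Fintype.mem_piFinset]
    exact hroot z hz
  refine ⟨(Finset.finite_toSet _).subset hsub, ?_⟩
  refine (Set.ncard_le_ncard hsub (Finset.finite_toSet _)).trans ?_
  rw [Set.ncard_coe_finset, Fintype.card_piFinset]
  calc ∏ i, (Q i).roots.toFinset.card ≤ ∏ _i : Fin n, (n * D + 1) ^ n :=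
        Finset.prod_le_prod' fun i _ => (Multiset.toFinset_card_le _).trans
          ((Polynomial.card_roots' _).trans (hQdeg i))
    _ = ((n * D + 1) ^ n) ^ n := by simp

end Bezout

/-! ### Symmetric multilinear forms and the polarised gradient -/

section Forms

variable {R : Type*} [CommRing R] {k r n : ℕ}

/-- The multilinear form with the given coefficients. -/
def polarForm (c : (Fin k → Fin n) → R) : MultilinearMap R (fun _ : Fin k => Fin n → R) R :=
  ∑ j, c j • (MultilinearMap.mkPiAlgebra R (Fin k) R).compLinearMap
    fun i => LinearMap.proj (j i)

theorem polarForm_apply (c : (Fin k → Fin n) → R) (h : Fin k → Fin n → R) :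
    polarForm c h = ∑ j, c j * ∏ i, h i (j i) := by
  simp [polarForm]

theorem polarForm_comp_perm {c : (Fin k → Fin n) → R} (hc : IsSymmCoeff c)
    (h : Fin k → Fin n → R) (σ : Equiv.Perm (Fin k)) : polarForm c (h ∘ σ) = polarForm c h := by
  rw [polarForm_apply, polarForm_apply]
  refine (Fintype.sum_equiv (Equiv.arrowCongr σ.symm (Equiv.refl _)) _ _ fun j => ?_).symm
  have : (Equiv.arrowCongr σ.symm (Equiv.refl (Fin n))) j = j ∘ σ := rfl
  rw [this, hc σ j]
  congr 1
  exact (Equiv.prod_comp σ fun i => h i (j i)).symm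

theorem polarForm_update_eq_sum (c : (Fin k → Fin n) → R) (h : Fin k → Fin n → R) (i : Fin k)
    (x : Fin n → R) : polarForm c (Function.update h i x) =
      ∑ m, x m * polarForm c (Function.update h i (Pi.single m 1)) := by
  conv_lhs => rw [pi_eq_sum_univ' x]
  rw [MultilinearMap.map_update_sum]
  exact Finset.sum_congr rfl fun m _ => by
    rw [MultilinearMap.map_update_smul, smul_eq_mul]

theorem polarForm_update_swap {c : (Fin k → Fin n) → R} (hc : IsSymmCoeff c)
    (h : Fin k → Fin n → R) (i j : Fin k) (x y : Fin n → R) (hij : i ≠ j) :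
    polarForm c (Function.update (Function.update h i x) j y) =
      polarForm c (Function.update (Function.update h i y) j x) := by
  rw [← polarForm_comp_perm hc _ (Equiv.swap i j)]
  congr 1
  funext l
  rcases eq_or_ne l i with rfl | hi
  · simp [Function.update_of_ne hij]
  rcases eq_or_ne l j with rfl | hj
  · simp [Function.update_of_ne hij]
  · simp [Equiv.swap_apply_of_ne_of_ne hi hj, hi, hj]

theorem polarForm_update_const {c : (Fin k → Fin n) → R} (hc : IsSymmCoeff c)
    (i j : Fin k) (x y : Fin n → R) :
    polarForm c (Function.update (fun _ => x) i y) =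
      polarForm c (Function.update (fun _ => x) j y) := by
  rcases eq_or_ne i j with rfl | hij
  · rfl
  have := polarForm_update_swap hc (fun _ => x) i j y x hij
  rwa [Function.update_comm hij, Function.update_eq_self j (fun _ => x),
    Function.update_eq_self i (fun _ => x)] at this

/-- The components of the gradient of the polarised form, as multilinear forms. -/
def gradForm (c : (Fin (r + 1) → Fin n) → R) (l : Fin n) (h : Fin r → Fin n → R) : R :=
  ∑ j : Fin r → Fin n, c (appendIndex (k := r + 1) j l) * ∏ i, h i (j i)

theorem appendIndex_eq_snoc (j : Fin r → Fin n) (l : Fin n) :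
    appendIndex (k := r + 1) j l = Fin.snoc j l := by
  funext i
  refine Fin.lastCases ?_ (fun i => ?_) i
  · simp [appendIndex]
  · simp [appendIndex]

theorem gradForm_eq_polarForm (c : (Fin (r + 1) → Fin n) → R) (l : Fin n)
    (h : Fin r → Fin n → R) :
    gradForm c l h = polarForm c (Fin.snoc (α := fun _ => Fin n → R) h (Pi.single l 1)) := by
  rw [polarForm_apply, ← (Fin.snocEquiv fun _ : Fin (r + 1) => Fin n).sum_comp,
    Fintype.sum_prod_type, Finset.sum_eq_single l]
  · refine Finset.sum_congr rfl fun j _ => ?_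
    rw [Fin.prod_univ_castSucc, appendIndex_eq_snoc]
    simp [Fin.snocEquiv]
  · intro m _ hm
    refine Finset.sum_eq_zero fun j _ => ?_
    rw [Fin.prod_univ_castSucc]
    simp [Fin.snocEquiv, Pi.single_eq_of_ne hm]
  · simp

theorem map_gradForm {S : Type*} [CommRing S] (f : R →+* S) (c : (Fin (r + 1) → Fin n) → R)
    (l : Fin n) (h : Fin r → Fin n → R) :
    f (gradForm c l h) = gradForm (fun j => f (c j)) l fun i m => f (h i m) := by
  simp [gradForm]

theorem gradForm_update_eq_sum (c : (Fin (r + 1) → Fin n) → R) (l : Fin n)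
    (h : Fin r → Fin n → R) (i : Fin r) (x : Fin n → R) :
    gradForm c l (Function.update h i x) =
      ∑ m, x m * gradForm c l (Function.update h i (Pi.single m 1)) := by
  simp only [gradForm_eq_polarForm, Fin.snoc_update]
  exact polarForm_update_eq_sum _ _ _ _

/-- The component index l acts as a basis vector in the last slot, so swapping that slot with slot i
exchanges l and m. This is the symmetry that the shrinking lemma needs. -/
theorem gradForm_update_comm {c : (Fin (r + 1) → Fin n) → R} (hc : IsSymmCoeff c) (l m : Fin n)
    (h : Fin r → Fin n → R) (i : Fin r) :
    gradForm c l (Function.update h i (Pi.single m 1)) =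
      gradForm c m (Function.update h i (Pi.single l 1)) := by
  have hs : ∀ a b : Fin n → R, (Fin.snoc (α := fun _ => Fin n → R) (Function.update h i a) b) =
      Function.update (Function.update (Fin.snoc (α := fun _ => Fin n → R) h 0) i.castSucc a)
        (Fin.last r) b := by
    intro a b
    rw [← Fin.snoc_update, Fin.update_snoc_last]
  rw [gradForm_eq_polarForm, gradForm_eq_polarForm, hs, hs]
  exact polarForm_update_swap hc _ _ _ _ _ (Fin.castSucc_lt_last i).ne

theorem gradForm_const (c : (Fin (r + 1) → Fin n) → R) (l : Fin n) (x : Fin n → R) :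
    gradForm c l (fun _ => x) =
      polarForm c (Function.update (fun _ => x) (Fin.last r) (Pi.single l 1)) := by
  rw [gradForm_eq_polarForm]
  congr 1
  funext i
  refine Fin.lastCases ?_ (fun i => ?_) i
  · simp
  · simp

end Forms

/-! ### Smoothness and the zeros of the gradient -/

section Smooth

variable {F : Type*} [Field F] {r n : ℕ} {K : Type*} [Field K] [Algebra F K]

theorem aeval_formOf (c : (Fin (r + 1) → Fin n) → F) (x : Fin n → K) :
    MvPolynomial.aeval x (formOf c) =
      ∑ l, x l * gradForm (fun j => algebraMap F K (c j)) l fun _ => x := by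
  simp only [gradForm_const]
  rw [← polarForm_update_eq_sum, Function.update_eq_self (Fin.last r) (fun _ => x),
    polarForm_apply]
  simp [formOf]

theorem derivation_prod {R A ι : Type*} [CommSemiring R] [CommSemiring A] [Algebra R A]
    [DecidableEq ι] (δ : Derivation R A A) (s : Finset ι) (f : ι → A) :
    δ (∏ i ∈ s, f i) = ∑ i ∈ s, (∏ j ∈ s.erase i, f j) * δ (f i) := by
  induction s using Finset.induction_on with
  | empty => simp
  | insert a s ha ih =>
    rw [Finset.prod_insert ha, Derivation.leibniz, ih, Finset.sum_insert ha,
      Finset.erase_insert ha, add_comm, smul_eq_mul, smul_eq_mul, Finset.mul_sum]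
    congr 1
    refine Finset.sum_congr rfl fun i hi => ?_
    have hia : i ≠ a := fun h => ha (h ▸ hi)
    rw [Finset.erase_insert_of_ne hia.symm,
      Finset.prod_insert fun h => ha (Finset.mem_of_mem_erase h), mul_assoc]

/-- The product rule gives one term for each of the r+1 positions, and these agree by symmetry. -/
theorem aeval_pderiv_formOf {c : (Fin (r + 1) → Fin n) → F} (hc : IsSymmCoeff c) (l : Fin n)
    (x : Fin n → K) : MvPolynomial.aeval x (MvPolynomial.pderiv l (formOf c)) =
      (r + 1 : ℕ) * gradForm (fun j => algebraMap F K (c j)) l fun _ => x := by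
  have hc' : IsSymmCoeff fun j => algebraMap F K (c j) := fun σ j => by simp only [hc σ j]
  have h : ∀ i : Fin (r + 1), polarForm (fun j => algebraMap F K (c j))
      (Function.update (fun _ => x) i (Pi.single l 1)) =
        gradForm (fun j => algebraMap F K (c j)) l fun _ => x := fun i => by
    rw [gradForm_const]
    exact polarForm_update_const hc' _ _ _ _
  have h2 : (r + 1 : ℕ) * gradForm (fun j => algebraMap F K (c j)) l (fun _ => x) =
      ∑ i : Fin (r + 1), polarForm (fun j => algebraMap F K (c j))
      (Function.update (fun _ => x) i (Pi.single l 1)) := by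
    simp [h]
  rw [h2]
  simp only [polarForm_apply]
  rw [Finset.sum_comm, formOf, map_sum, map_sum]
  refine Finset.sum_congr rfl fun j _ => ?_
  rw [MvPolynomial.pderiv_C_mul, map_mul, MvPolynomial.aeval_C, ← Finset.mul_sum]
  congr 1
  rw [derivation_prod, map_sum]
  refine Finset.sum_congr rfl fun i _ => ?_
  rw [← Finset.mul_prod_erase _ _ (Finset.mem_univ i), map_mul, map_prod,
    MvPolynomial.pderiv_X, mul_comm, Function.update_self]
  congr 1
  · rw [Pi.single_apply, Pi.single_apply, eq_comm]
    split_ifs <;> simp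
  · refine Finset.prod_congr rfl fun i' hi' => ?_
    rw [Function.update_of_ne (Finset.ne_of_mem_erase hi'), MvPolynomial.aeval_X]

theorem eq_zero_of_gradForm_eq_zero {c : (Fin (r + 1) → Fin n) → F} (hc : IsSymmCoeff c)
    (hsm : DefinesSmoothHypersurface (formOf c)) {x : Fin n → AlgebraicClosure F}
    (hx : ∀ l, gradForm (fun j => algebraMap F (AlgebraicClosure F) (c j)) l (fun _ => x) = 0) :
    x = 0 := by
  by_contra h
  obtain ⟨l, hl⟩ := hsm x h (by simp [aeval_formOf, hx])
  exact hl (by rw [aeval_pderiv_formOf hc, hx, mul_zero])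

/-- The gradient of a form as a vector of polynomials. -/
def gradPoly (c : (Fin (r + 1) → Fin n) → K) (l : Fin n) : MvPolynomial (Fin n) K :=
  gradForm (fun j => MvPolynomial.C (c j)) l fun _ => MvPolynomial.X

/-- Nullstellensatz: over the algebraic closure the gradient vanishes only at the origin. The sum of
the individual exponents serves for all variables. -/
theorem exists_X_pow_mem_span {c : (Fin (r + 1) → Fin n) → F} (hc : IsSymmCoeff c)
    (hsm : DefinesSmoothHypersurface (formOf c)) :
    ∃ M, ∀ i, MvPolynomial.X i ^ M ∈ Ideal.span (Set.range (gradPoly c)) := by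
  have h : ∀ i, ∃ M, MvPolynomial.X i ^ M ∈ Ideal.span (Set.range (gradPoly c)) := by
    intro i
    change MvPolynomial.X i ∈ (Ideal.span (Set.range (gradPoly c))).radical
    rw [← MvPolynomial.vanishingIdeal_zeroLocus_eq_radical (K := AlgebraicClosure F),
      MvPolynomial.mem_vanishingIdeal_iff]
    intro x hx
    rw [MvPolynomial.mem_zeroLocus_iff] at hx
    have : x = 0 := eq_zero_of_gradForm_eq_zero hc hsm fun l => by
      have h := hx _ (Ideal.subset_span ⟨l, rfl⟩)
      have h' := map_gradForm (MvPolynomial.aeval x :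
        MvPolynomial (Fin n) F →ₐ[F] AlgebraicClosure F).toRingHom
        (fun j => MvPolynomial.C (c j)) l fun _ => MvPolynomial.X
      simp only [AlgHom.toRingHom_eq_coe, RingHom.coe_coe, MvPolynomial.aeval_X,
        MvPolynomial.aeval_C] at h'
      rw [← h']
      exact h
    rw [MvPolynomial.aeval_X, this]; rfl
  choose M hM using h
  refine ⟨∑ i, M i, fun i => ?_⟩
  have : ∑ i, M i = M i + (∑ i, M i - M i) :=
    (Nat.add_sub_cancel' (Finset.single_le_sum (fun _ _ => Nat.zero_le _) (Finset.mem_univ i))).symm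
  rw [this, pow_add]
  exact Ideal.mul_mem_right _ _ (hM i)

/-- Ideal membership survives base change. This carries smoothness over F to the function field,
where the zeros are counted. -/
theorem X_pow_mem_span_gradPoly_map {c : (Fin (r + 1) → Fin n) → F} {M : ℕ}
    (hM : ∀ i, MvPolynomial.X i ^ M ∈ Ideal.span (Set.range (gradPoly c))) (i : Fin n) :
    MvPolynomial.X i ^ M ∈ Ideal.span (Set.range (gradPoly fun j => algebraMap F K (c j))) := by
  have h := Ideal.mem_map_of_mem (MvPolynomial.map (algebraMap F K)) (hM i)
  rw [map_pow, MvPolynomial.map_X, Ideal.map_span, ← Set.range_comp] at h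
  convert h using 4
  funext l
  simp [gradPoly, map_gradForm]

theorem isHomogeneous_gradPoly (c : (Fin (r + 1) → Fin n) → K) (l : Fin n) :
    (gradPoly c l).IsHomogeneous r := by
  refine MvPolynomial.IsHomogeneous.sum _ _ _ fun j _ => MvPolynomial.IsHomogeneous.C_mul ?_ _
  have := MvPolynomial.IsHomogeneous.prod Finset.univ
    (fun i : Fin r => (MvPolynomial.X (j i) : MvPolynomial (Fin n) K)) (fun _ => 1)
    fun i _ => MvPolynomial.isHomogeneous_X _ _
  simpa using this

theorem totalDegree_prod_add_C_sub_lt {ι σ : Type*} {s : Finset ι} (hs : s.Nonempty) (v : ι → σ)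
    (t : ι → K) : (∏ i ∈ s, (MvPolynomial.X (v i) + MvPolynomial.C (t i)) -
      ∏ i ∈ s, MvPolynomial.X (v i)).totalDegree < s.card := by
  induction hs using Finset.Nonempty.cons_induction with
  | singleton a => simp
  | cons a s ha hs ih =>
    rw [Finset.prod_cons, Finset.prod_cons, Finset.card_cons]
    have e : (MvPolynomial.X (v a) + MvPolynomial.C (t a)) *
          ∏ i ∈ s, (MvPolynomial.X (v i) + MvPolynomial.C (t i)) -
        MvPolynomial.X (v a) * ∏ i ∈ s, MvPolynomial.X (v i) =
        MvPolynomial.X (v a) * (∏ i ∈ s, (MvPolynomial.X (v i) + MvPolynomial.C (t i)) -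
          ∏ i ∈ s, MvPolynomial.X (v i)) +
        MvPolynomial.C (t a) * ∏ i ∈ s, (MvPolynomial.X (v i) + MvPolynomial.C (t i)) := by ring
    rw [e]
    refine (MvPolynomial.totalDegree_add _ _).trans_lt (max_lt ?_ ?_)
    · refine (MvPolynomial.totalDegree_mul _ _).trans_lt ?_
      rw [MvPolynomial.totalDegree_X]
      omega
    · refine (MvPolynomial.totalDegree_mul _ _).trans_lt ?_
      rw [MvPolynomial.totalDegree_C, zero_add, Nat.lt_succ_iff]
      refine (MvPolynomial.totalDegree_finsetProd _ _).trans ?_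
      refine (Finset.sum_le_sum (g := fun _ => 1) fun i _ => ?_).trans (by simp)
      refine (MvPolynomial.totalDegree_add _ _).trans ?_
      simp

/-- Translating the arguments changes only terms of lower degree, so the leading forms do not depend
on t. -/
theorem totalDegree_gradForm_sub_lt (hr : 0 < r) (c : (Fin (r + 1) → Fin n) → K) (l : Fin n)
    (t : Fin r → Fin n → K) :
    (gradForm (fun j => MvPolynomial.C (c j)) l
      (fun i m => MvPolynomial.X m + MvPolynomial.C (t i m)) - gradPoly c l).totalDegree < r := by
  rw [gradPoly, gradForm, gradForm, ← Finset.sum_sub_distrib]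
  refine lt_of_le_of_lt (b := r - 1) (MvPolynomial.totalDegree_finsetSum_le fun j _ => ?_)
    (by omega)
  rw [← mul_sub]
  refine (MvPolynomial.totalDegree_mul _ _).trans ?_
  have : (Finset.univ : Finset (Fin r)).Nonempty := ⟨⟨0, hr⟩, Finset.mem_univ _⟩
  have := totalDegree_prod_add_C_sub_lt this j fun i => t i (j i)
  rw [Finset.card_fin] at this
  rw [MvPolynomial.totalDegree_C]
  omega

/-- A bound for the number of zeros of the gradient form with prescribed differences. -/
theorem ncard_gradForm_translate_le (hr : 0 < r) {c : (Fin (r + 1) → Fin n) → F}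
    (hc : IsSymmCoeff c) (hsm : DefinesSmoothHypersurface (formOf c)) (t : Fin r → Fin n → K) :
    {z : Fin n → K | ∀ l, gradForm (fun j => algebraMap F K (c j)) l
        (fun i m => z m + t i m) = 0}.Finite ∧
      {z : Fin n → K | ∀ l, gradForm (fun j => algebraMap F K (c j)) l
        (fun i m => z m + t i m) = 0}.ncard ≤ ((n * r + 1) ^ n) ^ n := by
  obtain ⟨M, hM⟩ := exists_X_pow_mem_span hc hsm
  have := ncard_zeros_le (L := K) hr (isHomogeneous_gradPoly fun j => algebraMap F K (c j))
    (fun l => totalDegree_gradForm_sub_lt hr _ l t) (X_pow_mem_span_gradPoly_map hM)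
  simpa [map_gradForm] using this

end Smooth

/-! ### Fibrewise counting and zeros in a box -/

section Counting

theorem ncard_le_mul_ncard_of_fiber {α β : Type*} {A : Set α} {T : Set β} (hA : A.Finite)
    (hT : T.Finite) (f : α → β) (hf : Set.MapsTo f A T) (c : ℕ)
    (hc : ∀ b ∈ T, {a ∈ A | f a = b}.ncard ≤ c) : A.ncard ≤ c * T.ncard := by
  classical
  rw [Set.ncard_eq_toFinset_card _ hA, Set.ncard_eq_toFinset_card _ hT]
  refine Finset.card_le_mul_card_image_of_maps_to (f := f) (fun a ha => ?_) c fun b hb => ?_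
  · simpa using hf (by simpa using ha)
  · rw [← Set.ncard_coe_finset]
    simpa using hc b (by simpa using hb)

/-- Sets of functions can be compared slice by slice. -/
theorem ncard_le_mul_ncard_of_update {ι α : Type*} [DecidableEq ι] {A B : Set (ι → α)}
    (hA : A.Finite) (hB : B.Finite) (i : ι) (c : ℕ)
    (h : ∀ v, {x | Function.update v i x ∈ A}.ncard ≤
      c * {x | Function.update v i x ∈ B}.ncard) : A.ncard ≤ c * B.ncard := by
  classical
  rcases A.eq_empty_or_nonempty with rfl | ⟨a, ha⟩
  · simp
  -- Overwriting entry i by a fixed value selects one representative per slice, so A and B are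
  -- fibred over the same finite set.
  let π : (ι → α) → (ι → α) := fun u => Function.update u i (a i)
  let S : Finset (ι → α) := hA.toFinset.image π ∪ hB.toFinset.image π
  have hfib : ∀ {U : Set (ι → α)} (hU : U.Finite), ∀ v ∈ S,
      (hU.toFinset.filter fun u => π u = v).card = {x | Function.update v i x ∈ U}.ncard := by
    intro U hU v hv
    have hvi : v i = a i := by
      rcases Finset.mem_union.1 hv with hv | hv <;>
      · obtain ⟨u, _, rfl⟩ := Finset.mem_image.1 hv
        simp [π]
    rw [← Set.ncard_coe_finset]
    refine Set.ncard_congr (fun u _ => u i) ?_ ?_ ?_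
    · intro u hu
      simp only [Finset.coe_filter, Set.Finite.mem_toFinset, Set.mem_ofPred_eq] at hu
      rw [Set.mem_ofPred_eq, ← hu.2]
      simpa [π] using hu.1
    · intro u w hu hw huw
      simp only [Finset.coe_filter, Set.Finite.mem_toFinset, Set.mem_ofPred_eq] at hu hw
      have hπ : π u = π w := hu.2.trans hw.2.symm
      funext j
      rcases eq_or_ne j i with rfl | hj
      · exact huw
      · simpa [π, hj] using congr_fun hπ j
    · intro x hx
      refine ⟨Function.update v i x, ?_, by simp⟩
      simp only [Finset.coe_filter, Set.Finite.mem_toFinset, Set.mem_ofPred_eq]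
      refine ⟨hx, ?_⟩
      simp only [π, Function.update_idem]
      rw [← hvi, Function.update_eq_self]
  have hA' := Finset.card_eq_sum_card_fiberwise (f := π) (s := hA.toFinset) (t := S)
    fun u hu => Finset.mem_union_left _ (Finset.mem_image_of_mem _ hu)
  have hB' := Finset.card_eq_sum_card_fiberwise (f := π) (s := hB.toFinset) (t := S)
    fun u hu => Finset.mem_union_right _ (Finset.mem_image_of_mem _ hu)
  rw [Set.ncard_eq_toFinset_card _ hA, Set.ncard_eq_toFinset_card _ hB, hA', hB', Finset.mul_sum]
  refine Finset.sum_le_sum fun v hv => ?_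
  rw [hfib hA v hv, hfib hB v hv]
  exact h v

variable {F : Type*} [Field F] {n a e : ℕ}

theorem ncard_setOf_forall_mem_degreeLT :
    {u : Fin a → Fin n → F[X] | ∀ i l, u i l ∈ Polynomial.degreeLT F e}.ncard =
      Nat.card F ^ (e * n * a) := by
  let E : {u : Fin a → Fin n → F[X] | ∀ i l, u i l ∈ Polynomial.degreeLT F e} ≃
      (Fin a → Fin n → Polynomial.degreeLT F e) :=
    ⟨fun u i l => ⟨u.1 i l, u.2 i l⟩, fun v => ⟨fun i l => v i l, fun i l => (v i l).2⟩,
      fun _ => rfl, fun _ => rfl⟩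
  have hq : Nat.card (Polynomial.degreeLT F e) = Nat.card F ^ e := by
    rw [Nat.card_congr (Polynomial.degreeLTEquiv F e).toEquiv, Nat.card_pi]
    simp
  rw [← Nat.card_coe_set_eq, Nat.card_congr E, Nat.card_pi]
  simp only [Nat.card_pi, hq, Finset.prod_const, Finset.card_univ, Fintype.card_fin]
  rw [← pow_mul, ← pow_mul, mul_assoc]

variable [Finite F]

theorem finite_coe_degreeLT (e : ℕ) : Finite (Polynomial.degreeLT F e) :=
  Module.finite_of_finite F

theorem finite_setOf_forall_mem_degreeLT (e : Fin a → ℕ) :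
    {u : Fin a → Fin n → F[X] | ∀ i l, u i l ∈ Polynomial.degreeLT F (e i)}.Finite := by
  have h : {u : Fin a → Fin n → F[X] | ∀ i l, u i l ∈ Polynomial.degreeLT F (e i)} =
      Set.pi Set.univ fun i => Set.pi Set.univ fun _ => (Polynomial.degreeLT F (e i) : Set F[X]) :=
    by ext; simp
  rw [h]
  refine Set.Finite.pi fun i => Set.Finite.pi fun _ => ?_
  exact Set.finite_coe_iff.1 (finite_coe_degreeLT (e i))

/-- The number of zeros of the gradient form of a smooth form in a box of polynomials. -/
theorem ncard_gradForm_zeros_le {ρ : ℕ} {c : (Fin (ρ + 1 + 1) → Fin n) → F} (hc : IsSymmCoeff c)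
    (hsm : DefinesSmoothHypersurface (formOf c)) :
    {u : Fin (ρ + 1) → Fin n → F[X] | (∀ i l, u i l ∈ Polynomial.degreeLT F e) ∧
        ∀ l, gradForm (fun j => Polynomial.C (c j)) l u = 0}.ncard ≤
      ((n * (ρ + 1) + 1) ^ n) ^ n * Nat.card F ^ (e * n * ρ) := by
  rw [← ncard_setOf_forall_mem_degreeLT]
  have hfin := finite_setOf_forall_mem_degreeLT (F := F) (n := n) (a := ρ + 1) fun _ => e
  -- Fibre over the ρ differences with u_0, which again lie in the box. Within a fibre u_0
  -- determines the tuple and is a zero of a translated gradient over the fraction field.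
  refine ncard_le_mul_ncard_of_fiber (hfin.subset fun u hu => hu.1)
    (finite_setOf_forall_mem_degreeLT fun _ => e) (fun u (i : Fin ρ) => u i.succ - u 0) ?_ _ ?_
  · intro u hu i l
    exact Submodule.sub_mem _ (hu.1 i.succ l) (hu.1 0 l)
  · intro b _
    let ι : F[X] →+* FractionRing F[X] := algebraMap _ _
    have hι : Function.Injective ι := IsFractionRing.injective F[X] (FractionRing F[X])
    let t : Fin (ρ + 1) → Fin n → FractionRing F[X] :=
      Fin.cons 0 fun i l => ι (b i l)
    obtain ⟨hZ, hcard⟩ := ncard_gradForm_translate_le (Nat.succ_pos ρ) hc hsm t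
    refine le_trans ?_ hcard
    refine Set.ncard_le_ncard_of_injOn (fun u l => ι (u 0 l)) ?_ ?_ hZ
    · rintro u ⟨⟨_, hu⟩, hub⟩ l
      have h := congrArg ι (hu l)
      rw [map_gradForm, map_zero] at h
      rw [← h]
      congr 1
      funext i m
      refine Fin.cases ?_ (fun i => ?_) i
      · simp [t]
      · simp only [t, Fin.cons_succ]
        rw [← hub]
        change ι (u 0 m) + ι (u i.succ m - u 0 m) = _
        rw [map_sub]
        ring
    · rintro u ⟨_, hu⟩ w ⟨_, hw⟩ huw
      have h0 : u 0 = w 0 := funext fun l => hι (congr_fun huw l)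
      funext i
      refine Fin.cases h0 (fun i => ?_) i
      have := congr_fun (hu.trans hw.symm) i
      simpa [h0] using this

end Counting

/-! ### Shrinking the arguments one at a time -/

section Slots

variable {F : Type*} [Field F] {n r : ℕ}

/-- The tuples whose first `t` entries lie in the small box, the others in the large box, and
whose gradient form is annihilated by correspondingly many shifts of `φ`. -/
def slotSet (φ : F[X] →ₗ[F] F) (c : (Fin (r + 1) → Fin n) → F) (e s t : ℕ) :
    Set (Fin r → Fin n → F[X]) :=
  {u | (∀ (i : Fin r) l, u i l ∈ Polynomial.degreeLT F (if (i : ℕ) < t then e else e + s)) ∧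
    ∀ l, ∀ y < e + s + t * s,
      φ (Polynomial.X ^ y * gradForm (fun j => Polynomial.C (c j)) l u) = 0}

variable (φ : F[X] →ₗ[F] F) {c : (Fin (r + 1) → Fin n) → F} (e s : ℕ)

theorem finite_slotSet [Finite F] (t : ℕ) : (slotSet φ c e s t).Finite :=
  (finite_setOf_forall_mem_degreeLT fun i : Fin r => if (i : ℕ) < t then e else e + s).subset
    fun _ hu => hu.1

/-- The matrix of the gradient form as a function of one argument. -/
def slotMatrix (c : (Fin (r + 1) → Fin n) → F) (v : Fin r → Fin n → F[X]) (i : Fin r) :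
    Matrix (Fin n) (Fin n) F[X] :=
  Matrix.of fun l m => gradForm (fun j => Polynomial.C (c j)) l
    (Function.update v i (Pi.single m 1))

theorem isSymm_slotMatrix (hc : IsSymmCoeff c) (v : Fin r → Fin n → F[X]) (i : Fin r) :
    (slotMatrix c v i).IsSymm := by
  have hc' : IsSymmCoeff fun j => Polynomial.C (c j) := fun σ j => by simp only [hc σ j]
  exact Matrix.IsSymm.ext fun l m => gradForm_update_comm hc' m l v i

theorem slotMatrix_mulVec (v : Fin r → Fin n → F[X]) (i : Fin r) (x : Fin n → F[X]) (l : Fin n) :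
    (slotMatrix c v i).mulVec x l =
      gradForm (fun j => Polynomial.C (c j)) l (Function.update v i x) := by
  rw [gradForm_update_eq_sum, Matrix.mulVec, dotProduct]
  exact Finset.sum_congr rfl fun m _ => mul_comm _ _

/-- The gradient is linear in entry i, so each slice in that direction is empty or a `shrinkSpace`.
-/
theorem update_mem_slotSet {t : ℕ} (v : Fin r → Fin n → F[X]) (i : Fin r) (x : Fin n → F[X]) :
    Function.update v i x ∈ slotSet φ c e s t ↔
      (∀ i' : Fin r, i' ≠ i → ∀ l, v i' l ∈ Polynomial.degreeLT F (if (i' : ℕ) < t then e else e + s)) ∧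
        x ∈ shrinkSpace φ (slotMatrix c v i) (if (i : ℕ) < t then e else e + s)
          (e + s + t * s) := by
  simp only [mem_shrinkSpace, slotMatrix_mulVec]
  constructor
  · rintro ⟨h1, h2⟩
    refine ⟨fun i' hi' l => ?_, fun l => ?_, h2⟩
    · simpa [hi'] using h1 i' l
    · simpa using h1 i l
  · rintro ⟨h1, h2, h3⟩
    refine ⟨fun i' l => ?_, h3⟩
    rcases eq_or_ne i' i with rfl | hi'
    · simpa using h2 l
    · simpa [hi'] using h1 i' hi' l

/-- From t = i to t = i+1 only the box of entry i changes, and s shifts are gained: slice by slice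
this is the shrinking lemma. -/
theorem ncard_slotSet_le_succ [Finite F] (hc : IsSymmCoeff c) (i : Fin r) :
    (slotSet φ c e s i).ncard ≤ Nat.card F ^ (n * s) * (slotSet φ c e s (i + 1)).ncard := by
  refine ncard_le_mul_ncard_of_update (finite_slotSet φ e s _) (finite_slotSet φ e s _) i _
    fun v => ?_
  simp only [update_mem_slotSet]
  have hiff : (∀ i' : Fin r, i' ≠ i → ∀ l,
        v i' l ∈ Polynomial.degreeLT F (if (i' : ℕ) < i then e else e + s)) ↔
      ∀ i' : Fin r, i' ≠ i → ∀ l,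
        v i' l ∈ Polynomial.degreeLT F (if (i' : ℕ) < i + 1 then e else e + s) := by
    refine forall_congr' fun i' => forall_congr' fun hi' => ?_
    have : (i' : ℕ) < i ↔ (i' : ℕ) < i + 1 := by
      have := Fin.val_ne_of_ne hi'
      omega
    simp only [this]
  simp only [hiff]
  generalize (∀ i' : Fin r, i' ≠ i → ∀ l,
      v i' l ∈ Polynomial.degreeLT F (if (i' : ℕ) < i + 1 then e else e + s)) = P
  by_cases hv : P
  · simp only [hv, true_and, lt_irrefl, if_false, Nat.lt_succ_self, if_true]
    rw [add_mul, one_mul, ← add_assoc]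
    exact ncard_shrinkSpace_add_le φ _ (isSymm_slotMatrix hc v i) e s (Nat.le_add_right _ _)
  · simp only [hv, false_and, Set.ofPred_false, Set.ncard_empty]
    exact Nat.zero_le _

theorem ncard_slotSet_zero_le [Finite F] (hc : IsSymmCoeff c) {t : ℕ} (ht : t ≤ r) :
    (slotSet φ c e s 0).ncard ≤ Nat.card F ^ (n * s * t) * (slotSet φ c e s t).ncard := by
  induction t with
  | zero => simp
  | succ t ih =>
    refine (ih (by omega)).trans ?_
    rw [mul_add_one (n * s), pow_add, mul_assoc (_ ^ _)]
    exact Nat.mul_le_mul_left _ (ncard_slotSet_le_succ φ e s hc ⟨t, ht⟩)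

end Slots

/-! ### Laurent series, residues and the Hankel matrix -/

section Series

variable {F : Type*} [Field F]

theorem polyInf_C (a : F) : polyInf (Polynomial.C a) = HahnSeries.C a := by
  simp [polyInf]

theorem polyInf_X : polyInf (Polynomial.X : F[X]) = tInf F := by
  simp [polyInf]

theorem coeff_mul_tInf (β : SeriesInf F) (i : ℤ) : (β * tInf F).coeff i = β.coeff (i + 1) := by
  have := HahnSeries.coeff_mul_single_add (r := (1 : F)) (x := β) (a := i + 1) (b := -1)
  rw [mul_one, add_neg_cancel_right] at this
  exact this

theorem coeff_mul_tInf_pow (β : SeriesInf F) (y : ℕ) (i : ℤ) :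
    (β * tInf F ^ y).coeff i = β.coeff (i + y) := by
  induction y generalizing i with
  | zero => simp
  | succ y ih =>
    rw [pow_succ, ← mul_assoc, coeff_mul_tInf, ih]
    congr 1
    push_cast
    ring

theorem coeff_mul_polyInf (β : SeriesInf F) (p : F[X]) {N : ℕ} (hN : p.natDegree < N) (i : ℤ) :
    (β * polyInf p).coeff i = ∑ t ∈ Finset.range N, β.coeff (i + t) * p.coeff t := by
  conv_lhs => rw [p.as_sum_range' N hN]
  rw [map_sum, Finset.mul_sum, HahnSeries.coeff_sum]
  refine Finset.sum_congr rfl fun t _ => ?_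
  rw [← Polynomial.C_mul_X_pow_eq_monomial, map_mul, map_pow, polyInf_C, polyInf_X, mul_left_comm,
    HahnSeries.C_mul_eq_smul, HahnSeries.coeff_smul, coeff_mul_tInf_pow, smul_eq_mul, mul_comm]

theorem coeff_polyInf (p : F[X]) (t : ℕ) : (polyInf p).coeff (-t : ℤ) = p.coeff t := by
  have h := coeff_mul_polyInf 1 p (N := p.natDegree + t + 1) (by omega) (-t)
  rw [one_mul] at h
  rw [h, Finset.sum_eq_single t]
  · simp
  · intro t' _ hne
    rw [HahnSeries.coeff_one, if_neg (by omega), zero_mul]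
  · intro hnot
    exact absurd (Finset.mem_range.2 (by omega)) hnot

theorem le_absInf_of_coeff_ne_zero [Finite F] {β : SeriesInf F} {i : ℤ} (h : β.coeff i ≠ 0) :
    (Nat.card F : ℝ) ^ (-i) ≤ absInf β := by
  have hβ : β ≠ 0 := by rintro rfl; simp at h
  rw [absInf, if_neg hβ]
  refine zpow_le_zpow_right₀ ?_ (neg_le_neg (HahnSeries.order_le_of_coeff_ne_zero h))
  exact_mod_cast Nat.card_pos

theorem mem_degreeLT_of_absInf_lt [Finite F] {p : F[X]} {d : ℕ}
    (h : absInf (polyInf p) < (Nat.card F : ℝ) ^ d) : p ∈ Polynomial.degreeLT F d := by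
  rw [Polynomial.mem_degreeLT, Polynomial.degree_lt_iff_coeff_zero]
  intro t ht
  by_contra hne
  rw [← coeff_polyInf] at hne
  have h1 := le_absInf_of_coeff_ne_zero hne
  rw [neg_neg, zpow_natCast] at h1
  have h2 : (Nat.card F : ℝ) ^ d ≤ (Nat.card F : ℝ) ^ t :=
    pow_le_pow_right₀ (by exact_mod_cast Nat.card_pos) ht
  linarith

theorem coeff_eq_zero_of_normInf_lt [Finite F] {β : SeriesInf F} {d y : ℕ}
    (h : normInf β < (Nat.card F : ℝ) ^ (-(d : ℤ))) (hy : y < d) : β.coeff (1 + y) = 0 := by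
  by_contra hne
  have hf : (fracInf β).coeff (1 + y) = β.coeff (1 + y) := if_pos (by omega)
  rw [← hf] at hne
  have h1 := le_absInf_of_coeff_ne_zero hne
  have h2 : (Nat.card F : ℝ) ^ (-(d : ℤ)) ≤ (Nat.card F : ℝ) ^ (-(1 + y : ℤ)) :=
    zpow_le_zpow_right₀ (by exact_mod_cast Nat.card_pos) (by omega)
  have h3 : absInf (fracInf β) < (Nat.card F : ℝ) ^ (-(d : ℤ)) := h
  linarith

/-- The functional `p ↦` coefficient of `T⁻¹` in `α p`. -/
def residueFunctional (α : SeriesInf F) : F[X] →ₗ[F] F where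
  toFun p := (α * polyInf p).coeff 1
  map_add' p q := by rw [map_add, mul_add, HahnSeries.coeff_add]
  map_smul' a p := by
    rw [Polynomial.smul_eq_C_mul, map_mul, polyInf_C, mul_left_comm, HahnSeries.C_mul_eq_smul,
      HahnSeries.coeff_smul]
    rfl

/-- Turns conditions on the digits of αp after the point into linear conditions on shifts of p. -/
theorem residueFunctional_X_pow_mul (α : SeriesInf F) (y : ℕ) (p : F[X]) :
    residueFunctional α (Polynomial.X ^ y * p) = (α * polyInf p).coeff (1 + y) := by
  change (α * polyInf _).coeff 1 = _
  rw [map_mul, map_pow, polyInf_X, mul_comm (tInf F ^ y), ← mul_assoc, coeff_mul_tInf_pow]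

theorem coeff_seriesOf {D : ℕ} (b : Fin D → F) (i : Fin D) :
    (seriesOf b).coeff ((i : ℤ) + 1) = b i := by
  rw [seriesOf, HahnSeries.coeff_sum, Finset.sum_eq_single i]
  · simp
  · intro j _ hj
    rw [HahnSeries.coeff_single_of_ne]
    have := Fin.val_ne_of_ne hj
    omega
  · simp

/-- The vanishing residues say that the Hankel matrix kills the coefficient vector of p. Off the
major arcs its rank is m+1, the number of columns, so it is injective. -/
theorem eq_zero_of_notMem_majorArcs {D m : ℕ} {b : Fin D → F} (hb : b ∉ majorArcs F D m)
    {p : F[X]} (hp : p.natDegree ≤ m)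
    (h : ∀ y < D - m, residueFunctional (seriesOf b) (Polynomial.X ^ y * p) = 0) : p = 0 := by
  have hker : LinearMap.ker (hankel m b).mulVecLin = ⊥ := by
    by_contra hne
    have h1 := LinearMap.finrank_range_add_finrank_ker (hankel m b).mulVecLin
    have h2 : Module.finrank F (LinearMap.ker (hankel m b).mulVecLin) ≠ 0 := fun h0 =>
      hne (Submodule.finrank_eq_zero.1 h0)
    rw [Module.finrank_fintype_fun_eq_card, Fintype.card_fin] at h1
    apply hb
    change Module.finrank F (LinearMap.range (hankel m b).mulVecLin) ≤ m
    omega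
  have hv : (fun t : Fin (m + 1) => p.coeff t) ∈ LinearMap.ker (hankel m b).mulVecLin := by
    rw [LinearMap.mem_ker, Matrix.mulVecLin_apply]
    funext y
    have h1 := h y y.2
    rw [residueFunctional_X_pow_mul, coeff_mul_polyInf _ _ (Nat.lt_succ_of_le hp),
      Finset.sum_range] at h1
    rw [Pi.zero_apply, ← h1, Matrix.mulVec, dotProduct]
    refine Finset.sum_congr rfl fun t _ => ?_
    congr 1
    rw [hankel, Matrix.of_apply, ← coeff_seriesOf b]
    congr 1
    push_cast
    ring
  rw [hker, Submodule.mem_bot] at hv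
  ext t
  rw [Polynomial.coeff_zero]
  rcases le_or_gt t m with ht | ht
  · exact congr_fun hv ⟨t, Nat.lt_succ_of_le ht⟩
  · exact Polynomial.coeff_eq_zero_of_natDegree_lt (by omega)

end Series

/-! ### Assembling the minor arc bound -/

section Main

variable {F : Type*} [Field F] {n r : ℕ}

theorem natDegree_gradForm_le {c : (Fin (r + 1) → Fin n) → F} {e : ℕ} {u : Fin r → Fin n → F[X]}
    (hu : ∀ i l, u i l ∈ Polynomial.degreeLT F e) (l : Fin n) :
    (gradForm (fun j => Polynomial.C (c j)) l u).natDegree ≤ r * e := by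
  refine Polynomial.natDegree_sum_le_of_forall_le _ _ fun j _ => ?_
  refine (Polynomial.natDegree_C_mul_le _ _).trans ((Polynomial.natDegree_prod_le _ _).trans ?_)
  refine (Finset.sum_le_sum (g := fun _ => e) fun i _ => ?_).trans (by simp)
  exact Polynomial.natDegree_le_of_degree_le (Polynomial.mem_degreeLT.1 (hu i _)).le

theorem psi_eq_smul_gradForm (c : (Fin (r + 1) → Fin n) → F) (l : Fin n)
    (u : Fin r → Fin n → F[X]) :
    psi (k := r + 1) c l u =
      ((r + 1).factorial : F) • gradForm (fun j => Polynomial.C (c j)) l u := by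
  rw [Polynomial.smul_eq_C_mul, map_natCast]
  rfl

/-- The norm condition makes the coefficients of T^{-1}, …, T^{-(e+s)} vanish, and the factor (r+1)!
can be cancelled. -/
theorem countSet_subset_slotSet [Finite F] (c : (Fin (r + 1) → Fin n) → F)
    (hchar : ((r + 1).factorial : F) ≠ 0) (α : SeriesInf F) (e s : ℕ) :
    countSet (k := r + 1) (e + s) c α ⊆ slotSet (residueFunctional α) c e s 0 := by
  rintro u ⟨hu, hα⟩
  refine ⟨fun i l => ?_, fun l y hy => ?_⟩
  · rw [if_neg (Nat.not_lt_zero _)]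
    exact mem_degreeLT_of_absInf_lt (hu i l)
  · have h := coeff_eq_zero_of_normInf_lt (hα l) (y := y) (by omega)
    rw [← residueFunctional_X_pow_mul, psi_eq_smul_gradForm, mul_smul_comm, map_smul,
      smul_eq_mul] at h
    exact (mul_eq_zero.1 h).resolve_left hchar

/-- The count for a minor arc point, in terms of `e`. -/
theorem ncard_countSet_le [Finite F] {ρ : ℕ} {c : (Fin (ρ + 1 + 1) → Fin n) → F}
    (hc : IsSymmCoeff c) (hsm : DefinesSmoothHypersurface (formOf c))
    (hchar : ((ρ + 1 + 1).factorial : F) ≠ 0) {D m e s : ℕ} (hem : (ρ + 1) * e ≤ m)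
    (hD : D ≤ (ρ + 1 + 1) * (e + s)) {b : Fin D → F} (hb : b ∉ majorArcs F D m) :
    (countSet (k := ρ + 1 + 1) (e + s) c (seriesOf b)).Finite ∧
      (countSet (k := ρ + 1 + 1) (e + s) c (seriesOf b)).ncard ≤
        ((n * (ρ + 1) + 1) ^ n) ^ n * Nat.card F ^ (n * s * (ρ + 1) + e * n * ρ) := by
  set φ := residueFunctional (seriesOf b)
  have hsub := countSet_subset_slotSet c hchar (seriesOf b) e s
  have hfin := finite_slotSet φ (c := c) e s 0
  refine ⟨hfin.subset hsub, (Set.ncard_le_ncard hsub hfin).trans ?_⟩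
  refine (ncard_slotSet_zero_le φ e s hc le_rfl).trans ?_
  have hzero : slotSet φ c e s (ρ + 1) ⊆ {u : Fin (ρ + 1) → Fin n → F[X] |
      (∀ i l, u i l ∈ Polynomial.degreeLT F e) ∧
        ∀ l, gradForm (fun j => Polynomial.C (c j)) l u = 0} := by
    rintro u ⟨hu, hφ⟩
    have hu' : ∀ i l, u i l ∈ Polynomial.degreeLT F e := fun i l => by
      simpa only [i.2, if_true] using hu i l
    refine ⟨hu', fun l => eq_zero_of_notMem_majorArcs hb
      ((natDegree_gradForm_le hu' l).trans hem) fun y hy => hφ l y ?_⟩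
    -- Hence the available shifts number at least D - (ρ+1)e ≥ D - m, as many as the Hankel matrix
    -- has rows.
    have : (ρ + 1 + 1) * (e + s) = (ρ + 1) * e + (e + s + (ρ + 1) * s) := by ring
    omega
  have hfin' := (finite_setOf_forall_mem_degreeLT (F := F) (n := n) (a := ρ + 1) fun _ => e).subset
    (t := {u : Fin (ρ + 1) → Fin n → F[X] | (∀ i l, u i l ∈ Polynomial.degreeLT F e) ∧
        ∀ l, gradForm (fun j => Polynomial.C (c j)) l u = 0}) fun _ hu => hu.1
  have h := (Set.ncard_le_ncard hzero hfin').trans (ncard_gradForm_zeros_le hc hsm)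
  refine (Nat.mul_le_mul_left _ h).trans_eq ?_
  rw [pow_add]
  ring

end Main

end MinorArcs

end

theorem proposition6p2 (d k n : ℕ) (hk : 3 ≤ k) (hn : 2 ≤ n) (hd : k - 1 ≤ d) :
    ∃ C : ℝ, 0 < C ∧
      ∀ (F : Type u) [Field F] [Finite F], k < ringChar F →
      ∀ (f₀ : MvPolynomial (Fin n) F) (c : (Fin k → Fin n) → F),
        MinorArcs.IsSymmCoeff c → f₀ = MinorArcs.formOf c →
        MinorArcs.DefinesSmoothHypersurface f₀ →
      ∀ m : ℕ, d ≤ m → (m : ℝ) ≤ (k * d : ℝ) / 2 →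
      ∀ b : Fin (k * d) → F, b ∉ MinorArcs.majorArcs F (k * d) m →
        (MinorArcs.countSet d c (MinorArcs.seriesOf b)).Finite ∧
        ((MinorArcs.countSet d c (MinorArcs.seriesOf b)).ncard : ℝ) ≤
          C * (Nat.card F : ℝ) ^
            (((d * n * (k - 1) : ℕ) : ℤ) - ((n * (m / (k - 1)) : ℕ) : ℤ)) := by
  obtain ⟨ρ, rfl⟩ : ∃ ρ, k = ρ + 1 + 1 := ⟨k - 2, by omega⟩
  refine ⟨(((n * (ρ + 1) + 1) ^ n) ^ n : ℕ), by positivity, ?_⟩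
  rintro F _ _ hchar f₀ c hc rfl hsm m hdm hm b hb
  have hm' : 2 * m ≤ (ρ + 1 + 1) * d := by
    have : (2 * m : ℝ) ≤ ((ρ + 1 + 1 : ℕ) : ℝ) * d := by linarith
    exact_mod_cast this
  -- The largest e for which a gradient with arguments of degree < e is sure, by the bound (ρ+1)e,
  -- to have degree at most m.
  set e := m / (ρ + 1) with he
  have hem : (ρ + 1) * e ≤ m := Nat.mul_div_le m (ρ + 1)
  -- Uses m ≤ kd/2 and k ≤ 2(k-1).
  have hed : e ≤ d := by
    by_contra! hlt
    have h1 : (ρ + 1) * (d + 1) ≤ (ρ + 1) * e := Nat.mul_le_mul_left _ hlt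
    nlinarith
  obtain ⟨s, rfl⟩ := Nat.exists_eq_add_of_le hed
  have hfac : ((ρ + 1 + 1).factorial : F) ≠ 0 := by
    have hp : (ringChar F).Prime := CharP.char_is_prime F _
    rw [Ne, ringChar.spec, hp.dvd_factorial]
    omega
  obtain ⟨hfin, hcard⟩ := MinorArcs.ncard_countSet_le hc hsm hfac hem le_rfl hb
  refine ⟨hfin, ?_⟩
  have hexp : (((e + s) * n * (ρ + 1 + 1 - 1) : ℕ) : ℤ) - ((n * (m / (ρ + 1 + 1 - 1)) : ℕ) : ℤ) =
      ((n * s * (ρ + 1) + e * n * ρ : ℕ) : ℤ) := by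
    rw [Nat.add_sub_cancel, ← he]
    push_cast
    ring
  rw [hexp, zpow_natCast]
  exact_mod_cast hcard
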